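/- A Poisson algebra over a field $K$ is a commutative associative unital $K$-algebra $R$ with a $K$-bilinear Lie bracket $\{\cdot,\cdot\}$ satisfying the Leibniz rule $\{ab,c\}=a\{b,c\}+b\{a,c\}$. For a Poisson algebra $R$ put $\gamma_1(R)=R$ and $\gamma_{n+1}(R)=\{\gamma_n(R),R\}$ (linear span of the brackets) for $n\ge 1$, and put $R^{(0)}=R$ and $R^{(n)}=\{R^{(n-1)},R\}\cdot R$ (the ideal generated by the brackets) for $n\ge 1$. Call $R$ Lie nilpotent if $\gamma_{s+1}(R)=0$ for some $s\ge 0$, and strongly Lie nilpotent if $R^{(s)}=0$ for some $s\ge 0$. Let $L$ be a Lie algebra (of arbitrary dimension, not necessarily restricted) over a field $K$ of characteristic $p>0$. The symmetric algebra $S(L)$ is a Poisson algebra under the bracket that extends $\{u,v\}=[u,v]$ ($u,v\in L$) by bilinearity and the Leibniz rule. This bracket induces a Poisson bracket on the quotient algebra $\mathbf{s}(L)=S(L)/(v^p\mid v\in L)$, the truncated symmetric Poisson algebra of $L$. Theorem. The following conditions are equivalent: 1. $\mathbf{s}(L)$ is strongly Lie nilpotent; 2. $\mathbf{s}(L)$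 is Lie nilpotent; 3. $L$ is nilpotent and $\dim_K L^2<\infty$, where $L^2=[L,L]$. -/

import Mathlib

/-- A Poisson algebra over `K`: a commutative associative unital `K`-algebra `A` with a
`K`-bilinear bracket `{a, b} = PoissonAlgebra.bracket a b` which is a Lie bracket and satisfies
the Leibniz rule. -/
class PoissonAlgebra (K A : Type*) [CommRing K] [CommRing A] [Algebra K A] where
  /-- The Poisson bracket, as a `K`-bilinear map. -/
  bracket : A →ₗ[K] A →ₗ[K] A
  bracket_self : ∀ a : A, bracket a a = 0
  jacobi : ∀ a b c : A,
    bracket a (bracket b c) + bracket b (bracket c a) + bracket c (bracket a b) = 0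
  leibniz : ∀ a b c : A, bracket (a * b) c = a * bracket b c + b * bracket a c

namespace PoissonAlgebra

section Series

variable (K A : Type*) [CommRing K] [CommRing A] [Algebra K A] [PoissonAlgebra K A]

/-- The lower central series of a Poisson algebra as a Lie algebra, enumerated from `0`:
`lowerCentralSeries K A n` is `γ_{n+1}(A)`, where `γ_1(A) = A` and `γ_{n+1}(A)` is the `K`-span of
all brackets `{a, b}` with `a ∈ γ_n(A)`, `b ∈ A`. -/
def lowerCentralSeries : ℕ → Submodule K A
  | 0 => ⊤
  | n + 1 => Submodule.span K
      {x | ∃ a ∈ lowerCentralSeries n, ∃ b : A, bracket (K := K) a b = x}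

/-- The upper Lie powers of a Poisson algebra: `A^(0) = A`, and `A^(n+1) = {A^(n), A} · A` is the
ideal generated by all brackets `{a, b}` with `a ∈ A^(n)`, `b ∈ A`. -/
def upperLiePower : ℕ → Ideal A
  | 0 => ⊤
  | n + 1 => Ideal.span {x | ∃ a ∈ upperLiePower n, ∃ b : A, bracket (K := K) a b = x}

/-- `A` is Lie nilpotent: `γ_{s+1}(A) = 0` for some `s`. -/
def IsLieNilpotent : Prop := ∃ s : ℕ, lowerCentralSeries K A s = ⊥

/-- `A` is strongly Lie nilpotent: `A^(s) = 0` for some `s`. -/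
def IsStronglyLieNilpotent : Prop := ∃ s : ℕ, upperLiePower K A s = ⊥

end Series

end PoissonAlgebra

namespace SymmetricAlgebra

section Derivations

variable {K L : Type*} [CommRing K] [AddCommGroup L] [Module K L]

theorem derivation_ext {D E : Derivation K (SymmetricAlgebra K L) (SymmetricAlgebra K L)}
    (h : ∀ v, D (ι K L v) = E (ι K L v)) : D = E := by
  ext a
  induction a using SymmetricAlgebra.induction with
  | algebraMap r => simp
  | ι x => exact h x
  | mul a b ha hb => simp [Derivation.leibniz, ha, hb]
  | add a b ha hb => simp [ha, hb]

/-- The algebra homomorphism `a ↦ a + ε D(a)` to the dual numbers over `S(L)`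
with `D v = f v` for `v ∈ L`. -/
noncomputable def dualLift (f : L →ₗ[K] SymmetricAlgebra K L) :
    SymmetricAlgebra K L →ₐ[K] TrivSqZeroExt (SymmetricAlgebra K L) (SymmetricAlgebra K L) :=
  lift ((TrivSqZeroExt.inlAlgHom K (SymmetricAlgebra K L)
      (SymmetricAlgebra K L)).toLinearMap ∘ₗ ι K L +
    (TrivSqZeroExt.inrHom (SymmetricAlgebra K L) (SymmetricAlgebra K L)).restrictScalars K ∘ₗ f)

theorem dualLift_ι (f : L →ₗ[K] SymmetricAlgebra K L) (v : L) :
    dualLift f (ι K L v) = TrivSqZeroExt.inl (ι K L v) + TrivSqZeroExt.inr (f v) := by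
  simp [dualLift]

theorem fst_dualLift (f : L →ₗ[K] SymmetricAlgebra K L) (a : SymmetricAlgebra K L) :
    (dualLift f a).fst = a := by
  induction a using SymmetricAlgebra.induction with
  | algebraMap r => rw [AlgHom.commutes]; rfl
  | ι x => simp [dualLift_ι]
  | mul a b ha hb => simp [ha, hb]
  | add a b ha hb => simp [ha, hb]

/-- The unique `K`-derivation of `S(L)` that extends a given linear map `L → S(L)`. -/
noncomputable def derivationLift (f : L →ₗ[K] SymmetricAlgebra K L) :
    Derivation K (SymmetricAlgebra K L) (SymmetricAlgebra K L) where
  toFun a := (dualLift f a).snd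
  map_add' a b := by simp
  map_smul' r a := by simp
  map_one_eq_zero' := by simp
  leibniz' a b := by simp [fst_dualLift, mul_comm]

@[simp]
theorem derivationLift_ι (f : L →ₗ[K] SymmetricAlgebra K L) (v : L) :
    derivationLift f (ι K L v) = f v := by
  change (dualLift f (ι K L v)).snd = _
  simp [dualLift_ι]

end Derivations

section Poisson

variable {K L : Type*} [CommRing K] [LieRing L] [LieAlgebra K L]

/-- For `v ∈ L`, the derivation `a ↦ {a, v}` of `S(L)`, that is, the derivation which
extends `u ↦ [u, v]`. -/
noncomputable def rightAd (v : L) :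
    Derivation K (SymmetricAlgebra K L) (SymmetricAlgebra K L) :=
  derivationLift (-(ι K L ∘ₗ (LieAlgebra.ad K L v : L →ₗ[K] L)))

@[simp]
theorem rightAd_ι (v u : L) : rightAd (K := K) v (ι K L u) = ι K L ⁅u, v⁆ := by
  rw [rightAd, derivationLift_ι, ← lie_skew u v, map_neg]
  rfl

theorem rightAd_add (v w : L) : rightAd (K := K) (v + w) = rightAd v + rightAd w :=
  derivation_ext fun u => by simp

theorem rightAd_smul (r : K) (v : L) : rightAd (K := K) (r • v) = r • rightAd v :=
  derivation_ext fun u => by simp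

/-- For `a ∈ S(L)`, the derivation `b ↦ {a, b}` of `S(L)`, that is, the derivation which
extends `v ↦ {a, v}`, `v ∈ L`. -/
noncomputable def hamiltonian (a : SymmetricAlgebra K L) :
    Derivation K (SymmetricAlgebra K L) (SymmetricAlgebra K L) :=
  derivationLift
    { toFun := fun v => rightAd (K := K) v a
      map_add' := fun v w => by simp [rightAd_add]
      map_smul' := fun r v => by simp [rightAd_smul] }

@[simp]
theorem hamiltonian_ι (a : SymmetricAlgebra K L) (v : L) :
    hamiltonian a (ι K L v) = rightAd (K := K) v a := by
  simp [hamiltonian]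

theorem hamiltonian_add (a b : SymmetricAlgebra K L) :
    hamiltonian (a + b) = hamiltonian a + hamiltonian b :=
  derivation_ext fun u => by simp

theorem hamiltonian_smul (r : K) (a : SymmetricAlgebra K L) :
    hamiltonian (r • a) = r • hamiltonian a :=
  derivation_ext fun u => by simp

theorem hamiltonian_mul (a b : SymmetricAlgebra K L) :
    hamiltonian (a * b) = a • hamiltonian b + b • hamiltonian a :=
  derivation_ext fun u => by simp

theorem hamiltonian_algebraMap (r : K) :
    hamiltonian (algebraMap K (SymmetricAlgebra K L) r) = 0 :=
  derivation_ext fun u => by simp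

theorem hamiltonian_of_ι (v : L) (a : SymmetricAlgebra K L) :
    hamiltonian (ι K L v) a = -rightAd (K := K) v a := by
  have h : hamiltonian (ι K L v) = -rightAd (K := K) v :=
    derivation_ext fun u => by
      rw [hamiltonian_ι, Derivation.neg_apply, rightAd_ι, rightAd_ι, ← lie_skew u v, map_neg,
        neg_neg]
  rw [h, Derivation.neg_apply]

theorem hamiltonian_skew (a b : SymmetricAlgebra K L) :
    hamiltonian a b = -hamiltonian b a := by
  induction b using SymmetricAlgebra.induction with
  | algebraMap r => simp [hamiltonian_algebraMap]
  | ι x => rw [hamiltonian_ι, hamiltonian_of_ι, neg_neg]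
  | mul b c hb hc =>
    rw [hamiltonian_mul, Derivation.leibniz, hb, hc]
    simp only [Derivation.add_apply, Derivation.smul_apply, smul_eq_mul]
    ring
  | add b c hb hc =>
    rw [hamiltonian_add, map_add, hb, hc, Derivation.add_apply]
    ring

theorem hamiltonian_self (a : SymmetricAlgebra K L) : hamiltonian a a = 0 := by
  induction a using SymmetricAlgebra.induction with
  | algebraMap r => simp
  | ι x => simp
  | mul a b ha hb =>
    rw [hamiltonian_mul]
    simp only [Derivation.add_apply, Derivation.smul_apply, smul_eq_mul, Derivation.leibniz,
      ha, hb]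
    rw [hamiltonian_skew b a]
    ring
  | add a b ha hb =>
    rw [hamiltonian_add]
    simp only [Derivation.add_apply, map_add, ha, hb]
    rw [hamiltonian_skew b a]
    ring

theorem rightAd_lie (v w : L) : ⁅rightAd (K := K) v, rightAd (K := K) w⁆ = rightAd ⁅w, v⁆ :=
  derivation_ext fun u => by
    rw [Derivation.commutator_apply]
    simp only [rightAd_ι]
    rw [← map_sub]
    congr 1
    rw [leibniz_lie u w v, ← lie_skew w ⁅u, v⁆]
    abel

theorem rightAd_hamiltonian (v : L) (a : SymmetricAlgebra K L) :
    ⁅rightAd (K := K) v, hamiltonian a⁆ = hamiltonian (rightAd (K := K) v a) :=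
  derivation_ext fun w => by
    rw [Derivation.commutator_apply]
    simp only [rightAd_ι, hamiltonian_ι]
    rw [← rightAd_lie, Derivation.commutator_apply]
    abel

theorem hamiltonian_lie (a b : SymmetricAlgebra K L) :
    hamiltonian (hamiltonian a b) = ⁅hamiltonian a, hamiltonian b⁆ :=
  derivation_ext fun v => by
    have h := congrArg (fun D => D b) (rightAd_hamiltonian v a)
    simp only [Derivation.commutator_apply] at h
    rw [Derivation.commutator_apply]
    simp only [hamiltonian_ι]
    rw [hamiltonian_skew b, ← h]
    abel

/-- The Poisson algebra structure on the symmetric algebra `S(L)` of a Lie algebra `L`: the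
bracket with `{u, v} = [u, v]` for `u, v ∈ L`, extended by bilinearity and the Leibniz rule. -/
noncomputable instance instPoissonAlgebra : PoissonAlgebra K (SymmetricAlgebra K L) where
  bracket := LinearMap.mk₂ K (fun a b => hamiltonian a b)
    (fun a b c => by simp [hamiltonian_add]) (fun r a b => by simp [hamiltonian_smul])
    (fun a b c => by simp) (fun r a b => by simp)
  bracket_self a := hamiltonian_self a
  jacobi a b c := by
    simp only [LinearMap.mk₂_apply]
    rw [hamiltonian_skew c (hamiltonian a b), hamiltonian_lie, Derivation.commutator_apply,
      hamiltonian_skew c a, map_neg]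
    abel
  leibniz a b c := by simp [hamiltonian_mul]

theorem bracket_eq (a b : SymmetricAlgebra K L) :
    PoissonAlgebra.bracket (K := K) a b = hamiltonian a b := rfl

theorem bracket_ι_ι (u v : L) :
    PoissonAlgebra.bracket (K := K) (ι K L u) (ι K L v) = ι K L ⁅u, v⁆ := by
  simp [bracket_eq]

end Poisson

end SymmetricAlgebra

section Truncated

variable (K L : Type*) [CommRing K] [LieRing L] [LieAlgebra K L] (p : ℕ)

/-- The ideal `(v ^ p | v ∈ L)` of the symmetric algebra `S(L)`. -/
def truncationIdeal : Ideal (SymmetricAlgebra K L) :=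
  Ideal.span (Set.range fun v : L => SymmetricAlgebra.ι K L v ^ p)

/-- The truncated symmetric algebra `s(L) = S(L) / (v ^ p | v ∈ L)` of a Lie algebra `L` over a
ring of characteristic `p`. -/
abbrev TruncatedSymmetricAlgebra : Type _ := SymmetricAlgebra K L ⧸ truncationIdeal K L p

namespace TruncatedSymmetricAlgebra

variable {K L p}

theorem mk_smul (r : K) (a : SymmetricAlgebra K L) :
    r • Ideal.Quotient.mk (truncationIdeal K L p) a = Ideal.Quotient.mk _ (r • a) := rfl

variable [CharP K p]

theorem hamiltonian_mem (a : SymmetricAlgebra K L) {b : SymmetricAlgebra K L}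
    (hb : b ∈ truncationIdeal K L p) :
    SymmetricAlgebra.hamiltonian a b ∈ truncationIdeal K L p := by
  have hp : (p : SymmetricAlgebra K L) = 0 := by
    rw [← map_natCast (algebraMap K (SymmetricAlgebra K L)) p, CharP.cast_eq_zero, map_zero]
  induction hb using Submodule.span_induction with
  | mem x hx =>
    obtain ⟨v, rfl⟩ := hx
    simp [Derivation.leibniz_pow, hp]
  | zero => simp
  | add x y _ _ hx hy => rw [map_add]; exact add_mem hx hy
  | smul c x hx' hx =>
    rw [smul_eq_mul, Derivation.leibniz]
    exact add_mem (Ideal.mul_mem_left _ _ hx) (Ideal.mul_mem_right _ _ hx')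

/-- The function of two variables induced by the Poisson bracket of `S(L)` on `s(L)`. -/
noncomputable def bracketFun (x y : TruncatedSymmetricAlgebra K L p) :
    TruncatedSymmetricAlgebra K L p :=
  Quotient.liftOn₂' x y
    (fun a b => Ideal.Quotient.mk (truncationIdeal K L p)
      (PoissonAlgebra.bracket (K := K) a b))
    (by
      intro a b a' b' ha hb
      have ha' : a - a' ∈ truncationIdeal K L p := (Submodule.quotientRel_def _).mp ha
      have hb' : b - b' ∈ truncationIdeal K L p := (Submodule.quotientRel_def _).mp hb
      rw [Ideal.Quotient.eq]
      simp only [SymmetricAlgebra.bracket_eq]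
      have h1 := hamiltonian_mem a hb'
      have h2 := hamiltonian_mem b' ha'
      have : SymmetricAlgebra.hamiltonian a b - SymmetricAlgebra.hamiltonian a' b' =
          SymmetricAlgebra.hamiltonian a (b - b') -
            SymmetricAlgebra.hamiltonian b' (a - a') := by
        rw [map_sub, map_sub, SymmetricAlgebra.hamiltonian_skew b' a,
          SymmetricAlgebra.hamiltonian_skew b' a']
        ring
      rw [this]
      exact sub_mem h1 h2)

theorem bracketFun_mk (a b : SymmetricAlgebra K L) :
    bracketFun (Ideal.Quotient.mk (truncationIdeal K L p) a) (Ideal.Quotient.mk _ b) =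
      Ideal.Quotient.mk _ (PoissonAlgebra.bracket (K := K) a b) := rfl

/-- The bracket induced on `s(L)`, as a `K`-bilinear map. -/
noncomputable def bracketHom : TruncatedSymmetricAlgebra K L p →ₗ[K]
    TruncatedSymmetricAlgebra K L p →ₗ[K] TruncatedSymmetricAlgebra K L p :=
  LinearMap.mk₂ K bracketFun
    (fun x y z => by
      obtain ⟨a, rfl⟩ := Ideal.Quotient.mk_surjective x
      obtain ⟨b, rfl⟩ := Ideal.Quotient.mk_surjective y
      obtain ⟨c, rfl⟩ := Ideal.Quotient.mk_surjective z
      rw [← map_add, bracketFun_mk, bracketFun_mk, bracketFun_mk, ← map_add, map_add,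
        LinearMap.add_apply])
    (fun r x y => by
      obtain ⟨a, rfl⟩ := Ideal.Quotient.mk_surjective x
      obtain ⟨b, rfl⟩ := Ideal.Quotient.mk_surjective y
      simp only [mk_smul, bracketFun_mk, map_smul, LinearMap.smul_apply])
    (fun x y z => by
      obtain ⟨a, rfl⟩ := Ideal.Quotient.mk_surjective x
      obtain ⟨b, rfl⟩ := Ideal.Quotient.mk_surjective y
      obtain ⟨c, rfl⟩ := Ideal.Quotient.mk_surjective z
      simp only [← map_add, bracketFun_mk])
    (fun r x y => by
      obtain ⟨a, rfl⟩ := Ideal.Quotient.mk_surjective x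
      obtain ⟨b, rfl⟩ := Ideal.Quotient.mk_surjective y
      simp only [mk_smul, bracketFun_mk, map_smul])

theorem bracketHom_mk (a b : SymmetricAlgebra K L) :
    bracketHom (Ideal.Quotient.mk (truncationIdeal K L p) a) (Ideal.Quotient.mk _ b) =
      Ideal.Quotient.mk _ (PoissonAlgebra.bracket (K := K) a b) := rfl

/-- The Poisson algebra structure on `s(L)`, induced by that of `S(L)`. -/
noncomputable instance instPoissonAlgebra :
    PoissonAlgebra K (TruncatedSymmetricAlgebra K L p) where
  bracket := bracketHom
  bracket_self x := by
    obtain ⟨a, rfl⟩ := Ideal.Quotient.mk_surjective x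
    rw [bracketHom_mk, PoissonAlgebra.bracket_self, map_zero]
  jacobi x y z := by
    obtain ⟨a, rfl⟩ := Ideal.Quotient.mk_surjective x
    obtain ⟨b, rfl⟩ := Ideal.Quotient.mk_surjective y
    obtain ⟨c, rfl⟩ := Ideal.Quotient.mk_surjective z
    simp only [bracketHom_mk]
    rw [← map_add, ← map_add, PoissonAlgebra.jacobi, map_zero]
  leibniz x y z := by
    obtain ⟨a, rfl⟩ := Ideal.Quotient.mk_surjective x
    obtain ⟨b, rfl⟩ := Ideal.Quotient.mk_surjective y
    obtain ⟨c, rfl⟩ := Ideal.Quotient.mk_surjective z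
    rw [← map_mul, bracketHom_mk, bracketHom_mk, bracketHom_mk, PoissonAlgebra.leibniz,
      map_add, map_mul, map_mul]

/-- The quotient map `S(L) → s(L)` respects the Poisson brackets. -/
theorem bracket_mk (a b : SymmetricAlgebra K L) :
    PoissonAlgebra.bracket (K := K) (Ideal.Quotient.mk (truncationIdeal K L p) a)
        (Ideal.Quotient.mk _ b) =
      Ideal.Quotient.mk _ (PoissonAlgebra.bracket (K := K) a b) := rfl

end TruncatedSymmetricAlgebra

end Truncated

/-! Strong Lie nilpotency implies Lie nilpotency because the lower central series lies inside the
upper Lie powers.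

Necessity rests on one non-vanishing fact (`prod_iota_notMem_span`): a product of elements of `L`
independent modulo a subspace `U` stays outside the ideal of `s(L)` generated by `U`. So `L` embeds
in `s(L)` and inherits nilpotency. If some `[a, L]` were infinite-dimensional, nilpotency of `ad a`
would give arbitrarily many `y i` with `[[y i, a], a] = 0` and the `[y i, a]` independent modulo
`a`; bracketing with the elements `a * y i` then makes `a` divide the product of the `[y i, a]`, a
contradiction. With every `[a, L]` finite-dimensional, centralizers of finite-dimensional subspaces
have finite codimension. If `[L, L]` were infinite-dimensional, their commutators would lie in no
prescribed finite-dimensional space, which yields nonzero brackets of every length.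

For sufficiency, a factor from `γ_{i+1}(L)` gets weight `i`. Each bracket raises the weight by one,
so elements of high upper Lie powers are sums of monomials of high weight. If `L` is nilpotent, a
nonzero monomial of high weight has many factors in `[L, L]`, and a finite-dimensional `[L, L]`
generates a nilpotent ideal. -/

namespace PoissonAlgebra

/-! ### Bracket identities and the divisibility forced by Lie nilpotency -/

section Bracket

variable {K A : Type*} [CommRing K] [CommRing A] [Algebra K A] [PoissonAlgebra K A]

theorem bracket_skew (a b : A) : bracket (K := K) a b = -bracket (K := K) b a := by
  have h := bracket_self (K := K) (a + b)
  simp only [map_add, LinearMap.add_apply, bracket_self, zero_add, add_zero] at h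
  exact eq_neg_of_add_eq_zero_right h

theorem bracket_mul_right (a b c : A) :
    bracket (K := K) a (b * c) = b * bracket (K := K) a c + c * bracket (K := K) a b := by
  rw [bracket_skew, leibniz, bracket_skew c a, bracket_skew b a]
  ring

theorem bracket_one_left (a : A) : bracket (K := K) 1 a = 0 := by
  simpa using leibniz (K := K) (1 : A) 1 a

theorem bracket_algebraMap_right (a : A) (r : K) :
    bracket (K := K) a (algebraMap K A r) = 0 := by
  rw [bracket_skew, Algebra.algebraMap_eq_smul_one, map_smul, LinearMap.smul_apply,
    bracket_one_left, smul_zero, neg_zero]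

theorem bracket_prod_left_eq_zero {ι : Type*} (s : Finset ι) (f : ι → A) (b : A)
    (h : ∀ i ∈ s, bracket (K := K) (f i) b = 0) : bracket (K := K) (∏ i ∈ s, f i) b = 0 :=
  Finset.prod_induction f (fun x => bracket (K := K) x b = 0)
    (fun x y hx hy => by rw [leibniz, hx, hy, mul_zero, mul_zero, add_zero])
    (bracket_one_left b) h

theorem bracket_mem_lowerCentralSeries {n : ℕ} {a : A} (ha : a ∈ lowerCentralSeries K A n)
    (b : A) : bracket (K := K) a b ∈ lowerCentralSeries K A (n + 1) :=
  Submodule.subset_span ⟨a, ha, b, rfl⟩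

theorem lowerCentralSeries_le_upperLiePower (n : ℕ) :
    lowerCentralSeries K A n ≤ (upperLiePower K A n).restrictScalars K := by
  induction n with
  | zero => exact fun _ _ => Submodule.mem_top
  | succ n ih =>
    refine Submodule.span_le.2 ?_
    rintro _ ⟨a, ha, b, rfl⟩
    exact Ideal.subset_span ⟨a, ih ha, b, rfl⟩

theorem IsStronglyLieNilpotent.isLieNilpotent (h : IsStronglyLieNilpotent K A) :
    IsLieNilpotent K A := by
  obtain ⟨s, hs⟩ := h
  refine ⟨s, le_bot_iff.1 fun x hx => ?_⟩
  have := lowerCentralSeries_le_upperLiePower s hx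
  rwa [hs] at this

theorem eq_zero_of_mem_lowerCentralSeries_succ {s : ℕ} (hs : lowerCentralSeries K A s = ⊥)
    {x : A} (hx : x ∈ lowerCentralSeries K A (s + 1)) : x = 0 := by
  have h : lowerCentralSeries K A (s + 1) ≤ ⊥ := by
    refine Submodule.span_le.2 ?_
    rintro _ ⟨a, ha, b, rfl⟩
    rw [hs, Submodule.mem_bot] at ha
    simp [ha]
  exact h hx

/-- Left-normed brackets of the elements `a * y i` modulo the ideal generated by `a`. -/
theorem exists_mem_lowerCentralSeries_dvd_sub (a : A) (y : ℕ → A)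
    (hy : ∀ i, bracket (K := K) (bracket (K := K) (y i) a) a = 0) (k : ℕ) :
    ∃ w ∈ lowerCentralSeries K A k,
      a ∣ w - y k * ∏ i ∈ Finset.range k, bracket (K := K) (y i) a := by
  induction k with
  | zero => exact ⟨y 0, Submodule.mem_top, by simp⟩
  | succ k ih =>
    obtain ⟨w, hw, t, ht⟩ := ih
    -- Modulo `a`, only `y (k + 1) * {w, a}` survives from the bracket with `a * y (k + 1)`. Since
    -- `a` commutes with itself and with the earlier factors, `{w, a}` is `{y k, a}` times those
    -- factors.
    refine ⟨_, bracket_mem_lowerCentralSeries hw (a * y (k + 1)), ?_⟩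
    have hP : bracket (K := K) (∏ i ∈ Finset.range k, bracket (K := K) (y i) a) a = 0 :=
      bracket_prod_left_eq_zero _ _ _ fun i _ => hy i
    rw [Finset.prod_range_succ]
    rw [sub_eq_iff_eq_add] at ht
    rw [ht]
    generalize (∏ i ∈ Finset.range k, bracket (K := K) (y i) a) = P at hP
    simp only [map_add, LinearMap.add_apply, leibniz, bracket_mul_right, bracket_self, hP]
    exact Dvd.intro (t * bracket (K := K) a (y (k + 1)) + a * bracket (K := K) t (y (k + 1)) +
      y (k + 1) * bracket (K := K) t a + P * bracket (K := K) (y k) (y (k + 1)) +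
      y k * bracket (K := K) P (y (k + 1))) (by ring)

/-- The element `w` of the previous lemma vanishes at `k = s`. Bracketing the resulting relation `-y
s * P = a * t` with `a` keeps the right side divisible by `a` and turns `y s` into the last factor.
-/
theorem dvd_prod_bracket_of_lowerCentralSeries_eq_bot {s : ℕ}
    (hs : lowerCentralSeries K A s = ⊥) (a : A) (y : ℕ → A)
    (hy : ∀ i, bracket (K := K) (bracket (K := K) (y i) a) a = 0) :
    a ∣ ∏ i ∈ Finset.range (s + 1), bracket (K := K) (y i) a := by
  obtain ⟨w, hw, t, ht⟩ := exists_mem_lowerCentralSeries_dvd_sub a y hy s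
  have hP : bracket (K := K) (∏ i ∈ Finset.range s, bracket (K := K) (y i) a) a = 0 :=
    bracket_prod_left_eq_zero _ _ _ fun i _ => hy i
  rw [hs, Submodule.mem_bot] at hw
  have h := congrArg (fun x => bracket (K := K) x a) ht
  simp only [hw, map_neg, LinearMap.neg_apply, leibniz, bracket_self, hP, mul_zero, zero_add,
    add_zero, zero_sub] at h
  refine Dvd.intro (-bracket (K := K) t a) ?_
  rw [Finset.prod_range_succ, mul_neg, ← h, neg_neg]

end Bracket

end PoissonAlgebra

namespace TruncatedSymmetricAlgebra

/-! ### The canonical map from `L` and the universal property of `s(L)` -/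

section Iota

variable (K L : Type*) [CommRing K] [LieRing L] [LieAlgebra K L] (p : ℕ)

/-- The canonical map `L → s(L)`. -/
noncomputable def iota : L →ₗ[K] TruncatedSymmetricAlgebra K L p :=
  (Ideal.Quotient.mkₐ K (truncationIdeal K L p)).toLinearMap ∘ₗ SymmetricAlgebra.ι K L

variable {K L p}

theorem iota_pow (v : L) : iota K L p v ^ p = 0 :=
  Ideal.Quotient.eq_zero_iff_mem.2 (Ideal.subset_span ⟨v, rfl⟩)

theorem bracket_iota [CharP K p] (u v : L) :
    PoissonAlgebra.bracket (K := K) (iota K L p u) (iota K L p v) = iota K L p ⁅u, v⁆ := by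
  change Ideal.Quotient.mk _ (PoissonAlgebra.bracket (K := K) (SymmetricAlgebra.ι K L u)
    (SymmetricAlgebra.ι K L v)) = Ideal.Quotient.mk _ _
  rw [SymmetricAlgebra.bracket_ι_ι]

@[elab_as_elim]
theorem iota_induction {motive : TruncatedSymmetricAlgebra K L p → Prop}
    (algebraMap : ∀ r, motive (algebraMap K _ r)) (iota : ∀ v, motive (iota K L p v))
    (mul : ∀ a b, motive a → motive b → motive (a * b))
    (add : ∀ a b, motive a → motive b → motive (a + b))
    (a : TruncatedSymmetricAlgebra K L p) : motive a := by
  obtain ⟨a, rfl⟩ := Ideal.Quotient.mk_surjective a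
  induction a using SymmetricAlgebra.induction with
  | algebraMap r => exact algebraMap r
  | ι x => exact iota x
  | mul a b ha hb => rw [map_mul]; exact mul _ _ ha hb
  | add a b ha hb => rw [map_add]; exact add _ _ ha hb

theorem exists_algHom_iota {B : Type*} [CommRing B] [Algebra K B] (f : L →ₗ[K] B)
    (hf : ∀ v, f v ^ p = 0) :
    ∃ χ : TruncatedSymmetricAlgebra K L p →ₐ[K] B, ∀ v, χ (iota K L p v) = f v := by
  refine ⟨Ideal.Quotient.liftₐ _ (SymmetricAlgebra.lift f) fun a ha => ?_, fun v => ?_⟩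
  · have h : truncationIdeal K L p ≤ RingHom.ker (SymmetricAlgebra.lift f) := by
      refine Ideal.span_le.2 ?_
      rintro _ ⟨v, rfl⟩
      simp [RingHom.mem_ker, hf]
    exact h ha
  · change SymmetricAlgebra.lift f (SymmetricAlgebra.ι K L v) = f v
    simp

end Iota

/-! ### Nonvanishing of products of independent elements -/

section Independence

variable {K L : Type*} [Field K] [LieRing L] [LieAlgebra K L] {p : ℕ}

theorem _root_.MvPolynomial.prod_X_notMem_span_X_sq (n : ℕ) :
    ∏ i, (MvPolynomial.X i : MvPolynomial (Fin n) K) ∉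
      Ideal.span (Set.range fun i => (MvPolynomial.X i : MvPolynomial (Fin n) K) ^ 2) := by
  have h1 : (Set.range fun i => (MvPolynomial.X i : MvPolynomial (Fin n) K) ^ 2) =
      (fun s => MvPolynomial.monomial s (1 : K)) ''
        Set.range fun i : Fin n => Finsupp.single i 2 := by
    rw [← Set.range_comp]
    congr 1
    ext1 i
    simp [MvPolynomial.X_pow_eq_monomial]
  have h2 : ∏ i, (MvPolynomial.X i : MvPolynomial (Fin n) K) =
      MvPolynomial.monomial (∑ i, Finsupp.single i 1) 1 := by
    rw [MvPolynomial.monomial_sum_one]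
    rfl
  rw [h1, h2, MvPolynomial.mem_ideal_span_monomial_image]
  intro h
  obtain ⟨_, ⟨i, rfl⟩, hi⟩ := h (∑ i, Finsupp.single i 1) (by
    classical
    simp [MvPolynomial.mem_support_iff, MvPolynomial.coeff_monomial])
  have := hi i
  simp [Finsupp.finsetSum_apply, Finsupp.single_apply] at this

/-- The product of elements of `L` that are linearly independent modulo a subspace `U` does not
lie in the ideal of `s(L)` generated by `U`. -/
theorem prod_iota_notMem_span [CharP K p] [hp : Fact p.Prime] (U : Submodule K L) {n : ℕ}
    {v : Fin n → L} (hv : LinearIndependent K (U.mkQ ∘ v)) :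
    ∏ i, iota K L p (v i) ∉ Ideal.span (iota K L p '' (U : Set L)) := by
  let I := Ideal.span (Set.range fun i => (MvPolynomial.X i : MvPolynomial (Fin n) K) ^ 2)
  -- The target is `K[X_1, ..., X_n] / (X_i ^ 2)`. Characteristic `p` makes `p`-th powers additive
  -- there, so every combination of the `e i` has `p`-th power zero, as maps out of `s(L)` require.
  have : CharP (MvPolynomial (Fin n) K ⧸ I) p := by
    have : Nontrivial (MvPolynomial (Fin n) K ⧸ I) := Ideal.Quotient.nontrivial_iff.2 fun h =>
      MvPolynomial.prod_X_notMem_span_X_sq (K := K) n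
        (show _ ∈ I by rw [h]; trivial)
    exact charP_of_injective_algebraMap (algebraMap K _).injective p
  let e : Fin n → MvPolynomial (Fin n) K ⧸ I := fun i => Ideal.Quotient.mk I (MvPolynomial.X i)
  have he : ∀ i, e i ^ p = 0 := fun i => by
    have h2 : e i ^ 2 = 0 := by
      rw [← map_pow]
      exact Ideal.Quotient.eq_zero_iff_mem.2 (Ideal.subset_span ⟨i, rfl⟩)
    exact pow_eq_zero_of_le hp.out.two_le h2
  -- `g` reads off coordinates along the independent classes of the `v i`, so `f` kills `U` and
  -- sends `v i` to `e i`.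
  obtain ⟨g, hg⟩ := (Fintype.linearCombination K (U.mkQ ∘ v)).exists_leftInverse_of_injective
    (LinearMap.ker_eq_bot.2 (hv.fintypeLinearCombination_injective))
  let f : L →ₗ[K] MvPolynomial (Fin n) K ⧸ I := Fintype.linearCombination K e ∘ₗ g ∘ₗ U.mkQ
  have hf : ∀ u, f u ^ p = 0 := fun u => by
    have : f u = ∑ i, g (U.mkQ u) i • e i := rfl
    rw [this, sum_pow_char]
    exact Finset.sum_eq_zero fun i _ => by rw [smul_pow, he, smul_zero]
  have hfv : ∀ i, f (v i) = e i := fun i => by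
    have h1 : g (U.mkQ (v i)) = Pi.single i 1 := by
      simpa using LinearMap.congr_fun hg (Pi.single i 1)
    change Fintype.linearCombination K e (g (U.mkQ (v i))) = e i
    rw [h1]
    simp
  obtain ⟨χ, hχ⟩ := exists_algHom_iota f hf
  intro hmem
  have hker : Ideal.span (iota K L p '' (U : Set L)) ≤ RingHom.ker χ := by
    refine Ideal.span_le.2 ?_
    rintro _ ⟨u, hu, rfl⟩
    have : U.mkQ u = 0 := (Submodule.Quotient.mk_eq_zero U).2 hu
    simp only [SetLike.mem_coe, RingHom.mem_ker, hχ, f, LinearMap.comp_apply, this, map_zero]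
  have h := hker hmem
  rw [RingHom.mem_ker, map_prod] at h
  simp only [hχ, hfv, e] at h
  rw [← map_prod, Ideal.Quotient.eq_zero_iff_mem] at h
  exact MvPolynomial.prod_X_notMem_span_X_sq n h

theorem prod_iota_ne_zero [CharP K p] [Fact p.Prime] {n : ℕ} {v : Fin n → L}
    (hv : LinearIndependent K v) : ∏ i, iota K L p (v i) ≠ 0 := fun h => by
  refine prod_iota_notMem_span (p := p) (⊥ : Submodule K L) (v := v) ?_ (h ▸ zero_mem _)
  exact hv.map' _ (by simp)

theorem iota_injective [CharP K p] [Fact p.Prime] :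
    Function.Injective (iota K L p) := by
  refine (injective_iff_map_eq_zero _).2 fun v hv => by_contra fun h => ?_
  refine prod_iota_ne_zero (p := p) (v := fun _ : Fin 1 => v) ?_ (by simpa using hv)
  exact LinearIndependent.of_subsingleton 0 h

end Independence

end TruncatedSymmetricAlgebra

/-! ### Nilpotent endomorphisms and infinite-dimensional subspaces -/

section LinearAlgebra

variable {K V : Type*} [Field K] [AddCommGroup V] [Module K V]

/-- `D` maps `D (ker D^(k+1))` into `D (ker D^k)`, and the kernel of this map lies in `D (ker D^2)`.
Finiteness thus climbs with `k` until `D^k = 0`. -/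
theorem Submodule.fg_range_of_isNilpotent {D : Module.End K V} (hD : IsNilpotent D)
    (h : ((LinearMap.ker (D ^ 2)).map D).FG) : (LinearMap.range D).FG := by
  have key : ∀ k : ℕ, ((LinearMap.ker (D ^ k)).map D).FG := by
    intro k
    induction k with
    | zero =>
      rw [pow_zero, Module.End.one_eq_id, LinearMap.ker_id, Submodule.map_bot]
      exact Submodule.fg_bot
    | succ k ih =>
      refine Submodule.fg_of_fg_map_of_fg_inf_ker D (ih.of_le ?_) (h.of_le ?_)
      · refine Submodule.map_mono ?_
        rintro _ ⟨x, hx, rfl⟩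
        simpa [pow_succ] using hx
      · rintro _ ⟨⟨x, _, rfl⟩, hx⟩
        exact ⟨x, by simpa [pow_two] using hx, rfl⟩
  obtain ⟨n, hn⟩ := hD
  have := key n
  rwa [hn, LinearMap.ker_zero, Submodule.map_top] at this

theorem Submodule.exists_linearIndependent_of_not_fg {W : Submodule K V} (hW : ¬ W.FG) (n : ℕ) :
    ∃ w : Fin n → V, LinearIndependent K w ∧ ∀ i, w i ∈ W := by
  have h : (n : Cardinal) ≤ Module.rank K W := by
    refine (Cardinal.natCast_lt_aleph0.le).trans (not_lt.1 fun h => hW ?_)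
    exact Module.Finite.iff_fg.1 (Module.rank_lt_aleph0_iff.1 h)
  obtain ⟨f, hf⟩ := exists_linearIndependent_of_le_rank h
  exact ⟨fun i => f i, hf.map' W.subtype W.ker_subtype, fun i => (f i).2⟩

end LinearAlgebra

/-! ### Commutators in centralizers of finite-dimensional subspaces -/

section Centralizer

variable {K L : Type*} [Field K] [LieRing L] [LieAlgebra K L]

/-- If all `[a, L]` are finite-dimensional, but `[L, L]` is not, then the centralizer of a
finite-dimensional subspace `F` contains elements with bracket outside `F`. -/
theorem LieAlgebra.exists_lie_notMem_of_fg_range_ad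
    (had : ∀ a : L, (LinearMap.range (LieAlgebra.ad K L a : Module.End K L)).FG)
    (hL : ¬ (Submodule.span K {z : L | ∃ x y : L, ⁅x, y⁆ = z}).FG)
    {F : Submodule K L} (hF : F.FG) :
    ∃ x y : L, (∀ z ∈ F, ⁅x, z⁆ = 0) ∧ (∀ z ∈ F, ⁅y, z⁆ = 0) ∧ ⁅x, y⁆ ∉ F := by
  classical
  by_contra! hcon
  obtain ⟨T, rfl⟩ := id hF
  -- `C` centralizes a finite spanning set of `F`, hence `F`. It has finite codimension as a finite
  -- intersection of kernels of finite-rank maps.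
  let C : Submodule K L :=
    sInf (T.image fun b => LinearMap.ker (LieAlgebra.ad K L b : Module.End K L) : Finset _)
  have hC : C.CoFG := by
    refine Submodule.CoFG.sInf fun S hS => ?_
    obtain ⟨b, -, rfl⟩ := Finset.mem_image.1 hS
    exact Submodule.range_fg_iff_ker_cofg.1 (had b)
  have hCF : ∀ x ∈ C, ∀ z ∈ Submodule.span K (T : Set L), ⁅x, z⁆ = 0 := by
    intro x hx z hz
    induction hz using Submodule.span_induction with
    | mem b hb =>
      have : x ∈ LinearMap.ker (LieAlgebra.ad K L b : Module.End K L) :=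
        Submodule.mem_sInf.1 hx _ (Finset.mem_coe.2 (Finset.mem_image_of_mem _ hb))
      rw [← lie_skew, neg_eq_zero]
      simpa using this
    | zero => simp
    | add u v _ _ hu hv => rw [lie_add, hu, hv, add_zero]
    | smul r u _ hu => rw [lie_smul, hu, smul_zero]
  obtain ⟨G, hG⟩ := Submodule.exists_isCompl C
  obtain ⟨S, hS⟩ := hC.fg_of_isCompl hG
  let M : Submodule K L := Submodule.span K (T : Set L) ⊔
    ⨆ g ∈ S, LinearMap.range (LieAlgebra.ad K L g : Module.End K L)
  have hM : M.FG := hF.sup (Submodule.fg_biSup S _ fun g _ => had g)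
  have hGM : ∀ g ∈ G, ∀ y : L, ⁅g, y⁆ ∈ M := by
    intro g hg y
    rw [← hS] at hg
    induction hg using Submodule.span_induction with
    | mem b hb =>
      refine Submodule.mem_sup_right (Submodule.mem_iSup_of_mem b
        (Submodule.mem_iSup_of_mem hb ⟨y, rfl⟩))
    | zero => simp
    | add u v _ _ hu hv => rw [add_lie]; exact add_mem hu hv
    | smul r u _ hu => rw [smul_lie]; exact M.smul_mem r hu
  refine hL (hM.of_le (Submodule.span_le.2 ?_))
  rintro _ ⟨x, y, rfl⟩
  have hx : x ∈ C ⊔ G := hG.sup_eq_top ▸ Submodule.mem_top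
  have hy : y ∈ C ⊔ G := hG.sup_eq_top ▸ Submodule.mem_top
  obtain ⟨c, hc, g, hg, rfl⟩ := Submodule.mem_sup.1 hx
  obtain ⟨d, hd, e, he, rfl⟩ := Submodule.mem_sup.1 hy
  -- `[c + g, d + e] = [c, d] - [e, c] + [g, d + e]`: the first term lies in `F` by the assumption
  -- to be refuted, the others in `[G, L]`, which lies in `M`.
  rw [add_lie, lie_add c d e, ← lie_skew c e]
  exact add_mem (add_mem (Submodule.mem_sup_left (hcon c d (hCF c hc) (hCF d hd)))
    (neg_mem (hGM e he c))) (hGM g hg _)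

end Centralizer

namespace TruncatedSymmetricAlgebra

open PoissonAlgebra (bracket)

/-! ### Lie nilpotency of `s(L)` forces the conditions on `L` -/

section Necessity

variable {K L : Type*} [Field K] [LieRing L] [LieAlgebra K L] {p : ℕ} [CharP K p]

theorem iota_mem_lowerCentralSeries (k : ℕ) {v : L}
    (hv : v ∈ LieModule.lowerCentralSeries K L L k) :
    iota K L p v ∈ PoissonAlgebra.lowerCentralSeries K (TruncatedSymmetricAlgebra K L p) k := by
  induction k generalizing v with
  | zero => exact Submodule.mem_top
  | succ k ih =>
    rw [LieModule.lowerCentralSeries_succ, ← LieSubmodule.mem_toSubmodule,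
      LieSubmodule.lieIdeal_oper_eq_linear_span'] at hv
    have h : Submodule.span K {z : L | ∃ x ∈ (⊤ : LieIdeal K L),
        ∃ n ∈ LieModule.lowerCentralSeries K L L k, ⁅x, n⁆ = z} ≤
        (PoissonAlgebra.lowerCentralSeries K
          (TruncatedSymmetricAlgebra K L p) (k + 1)).comap (iota K L p) := by
      refine Submodule.span_le.2 ?_
      rintro _ ⟨x, -, n, hn, rfl⟩
      rw [SetLike.mem_coe, Submodule.mem_comap, ← lie_skew, map_neg, ← bracket_iota]
      exact neg_mem (PoissonAlgebra.bracket_mem_lowerCentralSeries (ih hn) _)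
    exact h hv

/-- Long nonzero brackets in `s(L)` if all `[a, L]` are finite-dimensional, but `[L, L]` is
not. -/
theorem exists_prod_mul_mem_lowerCentralSeries
    (had : ∀ a : L, (LinearMap.range (LieAlgebra.ad K L a : Module.End K L)).FG)
    (hL : ¬ (Submodule.span K {z : L | ∃ x y : L, ⁅x, y⁆ = z}).FG) (k : ℕ) :
    ∃ (z : Fin k → L) (x y : L), LinearIndependent K z ∧ (∀ i, ⁅z i, x⁆ = 0) ∧
      (∀ i, ⁅z i, y⁆ = 0) ∧ ⁅x, y⁆ ∉ Submodule.span K (Set.range z) ∧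
      (∏ i, iota K L p (z i)) * iota K L p x ∈
        PoissonAlgebra.lowerCentralSeries K (TruncatedSymmetricAlgebra K L p) k := by
  induction k with
  | zero =>
    obtain ⟨x, y, -, -, hxy⟩ := LieAlgebra.exists_lie_notMem_of_fg_range_ad had hL
      (F := ⊥) Submodule.fg_bot
    refine ⟨Fin.elim0, x, y, linearIndependent_empty_type, fun i => i.elim0, fun i => i.elim0,
      ?_, Submodule.mem_top⟩
    rwa [Set.range_eq_empty, Submodule.span_empty]
  | succ k ih =>
    obtain ⟨z, x, y, hz, hzx, hzy, hxy, hmem⟩ := ih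
    let z' : Fin (k + 1) → L := Fin.snoc z ⁅x, y⁆
    -- The old `x` is included in `F` so that `[x, x'] = 0`. Then bracketing `z_1 ⋯ z_k x` with `y *
    -- x'` leaves only `z_1 ⋯ z_k [x, y] x'`, a product of the same shape with one more `z`.
    obtain ⟨x', y', hx', hy', hxy'⟩ := LieAlgebra.exists_lie_notMem_of_fg_range_ad had hL
      (F := Submodule.span K (Set.range z' ∪ {x}))
      (Submodule.fg_span ((Set.finite_range z').union (Set.finite_singleton x)))
    have hz' : ∀ i, z' i ∈ Submodule.span K (Set.range z' ∪ {x}) := fun i =>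
      Submodule.subset_span (Or.inl ⟨i, rfl⟩)
    have hx'x : ⁅x', x⁆ = 0 := hx' x (Submodule.subset_span (Or.inr rfl))
    have hzx' : ∀ i, ⁅z' i, x'⁆ = 0 := fun i => by rw [← lie_skew, hx' _ (hz' i), neg_zero]
    refine ⟨z', x', y', linearIndependent_finSnoc.2 ⟨hz, hxy⟩, hzx', fun i => by
        rw [← lie_skew, hy' _ (hz' i), neg_zero], fun h => hxy' (Submodule.span_mono
        Set.subset_union_left h), ?_⟩
    have h := PoissonAlgebra.bracket_mem_lowerCentralSeries hmem (iota K L p y * iota K L p x')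
    have hP : bracket (K := K) (∏ i, iota K L p (z i)) (iota K L p y * iota K L p x') = 0 := by
      refine PoissonAlgebra.bracket_prod_left_eq_zero _ _ _ fun i _ => ?_
      have : ⁅z i, x'⁆ = 0 := by simpa [z'] using hzx' i.castSucc
      rw [PoissonAlgebra.bracket_mul_right, bracket_iota, bracket_iota, hzy, this]
      simp
    rw [PoissonAlgebra.leibniz, hP, PoissonAlgebra.bracket_mul_right, bracket_iota, bracket_iota,
      ← lie_skew x x', hx'x] at h
    rw [Fin.prod_univ_castSucc]
    simpa [z', mul_assoc, mul_comm (iota K L p x')] using h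

variable [Fact p.Prime]

theorem isNilpotent_of_isLieNilpotent
    (h : PoissonAlgebra.IsLieNilpotent K (TruncatedSymmetricAlgebra K L p)) :
    LieRing.IsNilpotent L := by
  obtain ⟨s, hs⟩ := h
  refine (LieModule.isNilpotent_iff K L L).2 ⟨s, (LieSubmodule.eq_bot_iff _).2 fun v hv => ?_⟩
  have := iota_mem_lowerCentralSeries (p := p) s hv
  rw [hs, Submodule.mem_bot] at this
  exact (map_eq_zero_iff _ iota_injective).1 this

/-- An infinite-dimensional range would supply `s + 1` elements `[y i, a]` independent modulo `a`
and commuting with `a`; divisibility of their product by `a` contradicts `prod_iota_notMem_span`. -/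
theorem fg_range_ad_of_isLieNilpotent
    (h : PoissonAlgebra.IsLieNilpotent K (TruncatedSymmetricAlgebra K L p)) (a : L) :
    (LinearMap.range (LieAlgebra.ad K L a : Module.End K L)).FG := by
  have := isNilpotent_of_isLieNilpotent h
  obtain ⟨s, hs⟩ := h
  by_contra hfg
  have hV := mt (Submodule.fg_range_of_isNilpotent
    (LieModule.isNilpotent_toEnd_of_isNilpotent K L L a)) hfg
  -- Passing to the quotient by the line through `a` loses at most one dimension.
  have hW := mt (fun h => Submodule.fg_of_fg_map_of_fg_inf_ker (Submodule.span K {a}).mkQ h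
    ((Submodule.fg_span_singleton a).of_le
      (inf_le_right.trans (Submodule.ker_mkQ _).le))) hV
  obtain ⟨w, hw, hwW⟩ := Submodule.exists_linearIndependent_of_not_fg hW (s + 1)
  have hx : ∀ i, ∃ x : L, ⁅a, ⁅a, x⁆⁆ = 0 ∧ (Submodule.span K {a}).mkQ ⁅a, x⁆ = w i := by
    intro i
    obtain ⟨_, ⟨x, hx, rfl⟩, hxw⟩ := hwW i
    exact ⟨x, by simpa [pow_two] using hx, hxw⟩
  choose x hx0 hxw using hx
  -- The sign turns `[a, x i]` into `[y i, a]`. The value `0` beyond `s` satisfies the commutation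
  -- hypothesis and never enters the product.
  let y : ℕ → L := fun i => if hi : i < s + 1 then -x ⟨i, hi⟩ else 0
  have hyx : ∀ i : Fin (s + 1), ⁅y i, a⁆ = ⁅a, x i⁆ := fun i => by
    simp only [y, dif_pos i.2, Fin.eta]
    rw [← lie_skew, lie_neg, neg_neg]
  have hy : ∀ i, ⁅⁅y i, a⁆, a⁆ = 0 := fun i => by
    by_cases hi : i < s + 1
    · rw [hyx ⟨i, hi⟩, ← lie_skew, hx0, neg_zero]
    · simp only [y, dif_neg hi, zero_lie]
  have hdvd := PoissonAlgebra.dvd_prod_bracket_of_lowerCentralSeries_eq_bot hs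
    (iota K L p a) (fun i => iota K L p (y i))
    (fun i => by rw [bracket_iota, bracket_iota, hy, map_zero])
  simp only [bracket_iota] at hdvd
  rw [Finset.prod_range] at hdvd
  refine prod_iota_notMem_span (p := p) (Submodule.span K {a}) (v := fun i => ⁅y i, a⁆) ?_
    (Ideal.mem_of_dvd _ hdvd (Ideal.subset_span ⟨a, Submodule.mem_span_singleton_self a, rfl⟩))
  have hwy : (Submodule.span K {a}).mkQ ∘ (fun i : Fin (s + 1) => ⁅y i, a⁆) = w := by
    ext1 i
    simp only [Function.comp_apply, hyx, hxw]
  rwa [hwy]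

theorem fg_span_lie_of_isLieNilpotent
    (h : PoissonAlgebra.IsLieNilpotent K (TruncatedSymmetricAlgebra K L p)) :
    (Submodule.span K {z : L | ∃ x y : L, ⁅x, y⁆ = z}).FG := by
  by_contra hL
  have had := fg_range_ad_of_isLieNilpotent h
  obtain ⟨s, hs⟩ := h
  obtain ⟨z, x, y, hz, -, hzy, hxy, hmem⟩ :=
    exists_prod_mul_mem_lowerCentralSeries (p := p) had hL s
  -- One more bracket, with `y`, replaces `x` by `[x, y]`, which is independent of the `z i`;
  -- independence of `x` itself is not known.
  have h := PoissonAlgebra.eq_zero_of_mem_lowerCentralSeries_succ hs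
    (PoissonAlgebra.bracket_mem_lowerCentralSeries hmem (iota K L p y))
  rw [PoissonAlgebra.leibniz, PoissonAlgebra.bracket_prod_left_eq_zero _ _ _
    (fun i _ => by rw [bracket_iota, hzy, map_zero]), bracket_iota, mul_zero, add_zero] at h
  refine prod_iota_ne_zero (p := p) (linearIndependent_finSnoc.2 ⟨hz, hxy⟩) ?_
  rw [Fin.prod_univ_castSucc]
  simpa using h

end Necessity

/-! ### Weights, and strong Lie nilpotency of `s(L)` -/

section Sufficiency

variable (K L : Type*) [Field K] [LieRing L] [LieAlgebra K L] (p : ℕ)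

/-- Products of elements of `L`, where a factor from the `i`-th term (counted from `0`) of the
lower central series contributes `i` to the weight. -/
inductive IsWeightedMonomial : ℕ → TruncatedSymmetricAlgebra K L p → Prop
  | one : IsWeightedMonomial 0 1
  | mul {n i : ℕ} {x : TruncatedSymmetricAlgebra K L p} {v : L} :
      IsWeightedMonomial n x → v ∈ LieModule.lowerCentralSeries K L L i →
        IsWeightedMonomial (n + i) (x * iota K L p v)

/-- The span of the weighted monomials of weight `n`. -/
noncomputable def weightSpan (n : ℕ) : Submodule K (TruncatedSymmetricAlgebra K L p) :=
  Submodule.span K {x | IsWeightedMonomial K L p n x}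

variable {K L p}

theorem mul_iota_mem_weightSpan {n i : ℕ} {x : TruncatedSymmetricAlgebra K L p} {v : L}
    (hx : x ∈ weightSpan K L p n) (hv : v ∈ LieModule.lowerCentralSeries K L L i) :
    x * iota K L p v ∈ weightSpan K L p (n + i) := by
  induction hx using Submodule.span_induction with
  | mem x hx => exact Submodule.subset_span (hx.mul hv)
  | zero => simp
  | add x y _ _ hx hy => rw [add_mul]; exact add_mem hx hy
  | smul r x _ hx => rw [smul_mul_assoc]; exact Submodule.smul_mem _ r hx

theorem mul_mem_weightSpan {n : ℕ} {x : TruncatedSymmetricAlgebra K L p}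
    (hx : x ∈ weightSpan K L p n) (a : TruncatedSymmetricAlgebra K L p) :
    x * a ∈ weightSpan K L p n := by
  induction a using iota_induction generalizing x with
  | algebraMap r =>
    rw [mul_comm, ← Algebra.smul_def]
    exact Submodule.smul_mem _ r hx
  | iota v =>
    exact mul_iota_mem_weightSpan (i := 0) hx (by
      rw [LieModule.lowerCentralSeries_zero]; exact LieSubmodule.mem_top v)
  | mul a b ha hb => rw [← mul_assoc]; exact hb (ha hx)
  | add a b ha hb => rw [mul_add]; exact add_mem (ha hx) (hb hx)

theorem lie_mem_lowerCentralSeries_succ {i : ℕ} {v : L}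
    (hv : v ∈ LieModule.lowerCentralSeries K L L i) (w : L) :
    ⁅v, w⁆ ∈ LieModule.lowerCentralSeries K L L (i + 1) := by
  rw [LieModule.lowerCentralSeries_succ, ← lie_skew]
  exact neg_mem (LieSubmodule.lie_mem_lie (LieSubmodule.mem_top w) hv)

/-- By the Leibniz rule it suffices to bracket a monomial with some `w` in `L`; this moves one
factor a step down the lower central series of `L`. -/
theorem bracket_mem_weightSpan [CharP K p] {n : ℕ} {x : TruncatedSymmetricAlgebra K L p}
    (hx : x ∈ weightSpan K L p n) (a : TruncatedSymmetricAlgebra K L p) :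
    bracket (K := K) x a ∈ weightSpan K L p (n + 1) := by
  induction a using iota_induction with
  | algebraMap r => rw [PoissonAlgebra.bracket_algebraMap_right]; exact zero_mem _
  | iota w =>
    induction hx using Submodule.span_induction with
    | mem x hx =>
      induction hx with
      | one => rw [PoissonAlgebra.bracket_one_left]; exact zero_mem _
      | @mul n i x v hx hv ih =>
        rw [PoissonAlgebra.leibniz, bracket_iota, mul_comm (iota K L p v)]
        refine add_mem (mul_iota_mem_weightSpan (i := i + 1) (Submodule.subset_span hx)
          (lie_mem_lowerCentralSeries_succ hv w)) ?_
        rw [add_right_comm]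
        exact mul_iota_mem_weightSpan ih hv
    | zero => simp
    | add x y _ _ hx hy => rw [map_add, LinearMap.add_apply]; exact add_mem hx hy
    | smul r x _ hx => rw [map_smul, LinearMap.smul_apply]; exact Submodule.smul_mem _ r hx
  | mul a b ha hb =>
    rw [PoissonAlgebra.bracket_mul_right, mul_comm a, mul_comm b]
    exact add_mem (mul_mem_weightSpan hb a) (mul_mem_weightSpan ha b)
  | add a b ha hb => rw [map_add]; exact add_mem ha hb

theorem upperLiePower_le_weightSpan [CharP K p] (n : ℕ)
    {x : TruncatedSymmetricAlgebra K L p}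
    (hx : x ∈ PoissonAlgebra.upperLiePower K (TruncatedSymmetricAlgebra K L p) n) :
    x ∈ weightSpan K L p n := by
  induction n generalizing x with
  | zero =>
    rw [← one_mul x]
    exact mul_mem_weightSpan (Submodule.subset_span .one) x
  | succ n ih =>
    induction hx using Submodule.span_induction with
    | mem x hx =>
      obtain ⟨a, ha, b, rfl⟩ := hx
      exact bracket_mem_weightSpan (ih ha) b
    | zero => exact zero_mem _
    | add x y _ _ hx hy => exact add_mem hx hy
    | smul r x _ hx => rw [smul_eq_mul, mul_comm]; exact mul_mem_weightSpan hx r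

/-- Only factors from `[L, L]` carry positive weight, and a nonzero factor has weight below `c`. So
`m` such factors account for weight at most `m * c`. -/
theorem IsWeightedMonomial.exists_mem_pow {c : ℕ}
    (hc : LieModule.lowerCentralSeries K L L c = ⊥) {n : ℕ}
    {x : TruncatedSymmetricAlgebra K L p} (hx : IsWeightedMonomial K L p n x) :
    ∃ m, n ≤ m * c ∧
      x ∈ Ideal.span (iota K L p '' (LieModule.lowerCentralSeries K L L 1 : Set L)) ^ m ∨
      x = 0 := by
  induction hx with
  | one => exact ⟨0, Or.inl ⟨by simp, by simp⟩⟩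
  | @mul n i x v hx hv ih =>
    obtain ⟨m, ⟨hm, hxm⟩ | rfl⟩ := ih
    · rcases le_or_gt c i with hci | hci
      · have : v = 0 := by
          have := LieModule.antitone_lowerCentralSeries K L L hci hv
          rwa [hc, LieSubmodule.mem_bot] at this
        exact ⟨0, Or.inr (by simp [this])⟩
      · rcases Nat.eq_zero_or_pos i with rfl | hi
        · exact ⟨m, Or.inl ⟨hm, Ideal.mul_mem_right _ _ hxm⟩⟩
        · refine ⟨m + 1, Or.inl ⟨by rw [add_mul, one_mul]; omega, ?_⟩⟩
          rw [Submodule.pow_succ]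
          exact Ideal.mul_mem_mul hxm (Ideal.subset_span
            ⟨v, LieModule.antitone_lowerCentralSeries K L L hi hv, rfl⟩)
    · exact ⟨0, Or.inr (zero_mul _)⟩

/-- A finite spanning set of `U` generates the ideal, and each generator is nilpotent because its
`p`-th power is zero. -/
theorem isNilpotent_span_iota {U : Submodule K L} (hU : U.FG) :
    IsNilpotent (Ideal.span (iota K L p '' (U : Set L))) := by
  obtain ⟨S, rfl⟩ := hU
  have h : Ideal.span (iota K L p '' (Submodule.span K (S : Set L) : Set L)) =
      Ideal.span (iota K L p '' (S : Set L)) := by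
    refine le_antisymm (Ideal.span_le.2 ?_)
      (Ideal.span_mono (Set.image_mono Submodule.subset_span))
    rintro _ ⟨v, hv, rfl⟩
    induction hv using Submodule.span_induction with
    | mem v hv => exact Ideal.subset_span ⟨v, hv, rfl⟩
    | zero => simp
    | add u v _ _ hu hv => rw [map_add]; exact add_mem hu hv
    | smul r v _ hv => rw [map_smul]; exact Submodule.smul_of_tower_mem _ r hv
  rw [h, Ideal.FG.isNilpotent_iff_le_nilradical
    (Submodule.fg_span (S.finite_toSet.image _)), Ideal.span_le]
  rintro _ ⟨v, -, rfl⟩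
  exact ⟨p, iota_pow v⟩

theorem isStronglyLieNilpotent_of_isNilpotent [CharP K p] [LieRing.IsNilpotent L]
    (hL : (LieModule.lowerCentralSeries K L L 1).toSubmodule.FG) :
    PoissonAlgebra.IsStronglyLieNilpotent K (TruncatedSymmetricAlgebra K L p) := by
  obtain ⟨c, hc⟩ := LieModule.IsNilpotent.nilpotent K L L
  obtain ⟨M, hM⟩ := isNilpotent_span_iota (p := p) hL
  -- A monomial of weight `M * c + 1` that lies in the `m`-th power with `M * c + 1 ≤ m * c` has `M
  -- < m`, so that power is already zero.
  refine ⟨M * c + 1, (Submodule.eq_bot_iff _).2 fun x hx => ?_⟩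
  have h : weightSpan K L p (M * c + 1) ≤ ⊥ := by
    refine Submodule.span_le.2 fun y hy => ?_
    obtain ⟨m, ⟨hm, hym⟩ | rfl⟩ := IsWeightedMonomial.exists_mem_pow hc hy
    · have hMm : M ≤ m := (Nat.lt_of_mul_lt_mul_right hm).le
      have h0 := hM.le (Ideal.pow_le_pow_right hMm hym)
      exact (Submodule.mem_bot K).2 ((Submodule.mem_bot _).1 h0)
    · exact zero_mem _
  exact h (upperLiePower_le_weightSpan _ hx)

end Sufficiency

end TruncatedSymmetricAlgebra

theorem mainTheorem1 {K L : Type*} [Field K] (p : ℕ) (hp : 0 < p) [CharP K p]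
    [LieRing L] [LieAlgebra K L] :
    List.TFAE [
      PoissonAlgebra.IsStronglyLieNilpotent K (TruncatedSymmetricAlgebra K L p),
      PoissonAlgebra.IsLieNilpotent K (TruncatedSymmetricAlgebra K L p),
      LieRing.IsNilpotent L ∧
        FiniteDimensional K (⁅(⊤ : LieIdeal K L), (⊤ : LieIdeal K L)⁆ : LieIdeal K L)] := by
  have : Fact p.Prime := ⟨(CharP.char_is_prime_or_zero K p).resolve_right hp.ne'⟩
  tfae_have 1 → 2 := PoissonAlgebra.IsStronglyLieNilpotent.isLieNilpotent
  tfae_have 2 → 3 := fun h => by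
    refine ⟨TruncatedSymmetricAlgebra.isNilpotent_of_isLieNilpotent h, ?_⟩
    have hfg := TruncatedSymmetricAlgebra.fg_span_lie_of_isLieNilpotent h
    refine (Module.Finite.iff_fg
      (N := (⁅(⊤ : LieIdeal K L), (⊤ : LieIdeal K L)⁆ : LieIdeal K L).toSubmodule)).2 ?_
    rw [LieSubmodule.lieIdeal_oper_eq_linear_span']
    simpa using hfg
  tfae_have 3 → 1 := fun ⟨hnil, hfin⟩ =>
    TruncatedSymmetricAlgebra.isStronglyLieNilpotent_of_isNilpotent ((Module.Finite.iff_fg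
      (N := (⁅(⊤ : LieIdeal K L), (⊤ : LieIdeal K L)⁆ : LieIdeal K L).toSubmodule)).1 hfin)
  tfae_finish
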